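/- Let $k\ge 1$ and let $N_1,\dots,N_k$ be integers with $N_j\le -2$ for all $j$. A digit system $(V,\varphi,D)$ consists of an abelian group $V$, an endomorphism $\varphi$ of $V$ with finite cokernel, and a finite set $D\subset V$ meeting every coset of $\varphi(V)$. An element $v\in V$ has a finite expansion in $(V,\varphi,D)$ if $v=\sum_{i=0}^{\ell}\varphi^i(d_i)$ for some $\ell\ge 0$ and $d_0,\dots,d_\ell\in D$. A monic nonconstant polynomial $f\in\mathbb Z[x]$ with $f(0)\ne 0$ is called a CNS polynomial if, for $X$ the class of $x$ in $\mathbb Z[x]/(f)$, every element of $\mathbb Z[x]/(f)$ has a finite expansion in the digit system $(\mathbb Z[x]/(f),\,X\cdot,\,\{0,1,\dots,|f(0)|-1\})$. (a) Suppose that $N_1,\dots,N_k$ are distinct. If $\prod_{j=1}^k(x-N_j)$ is a CNS polynomial, then every integer $a$ has a simultaneous expansion $$a=\sum_{i=0}^{\ell}d_iN_j^i\qquad(j=1,\dots,k)$$ with digits $d_i\in\{0,1,\dots,|N_1\cdots N_k|-1\}$ that are the same for all $k$ bases $N_j$, and the digit sequence is unique up to leading zeros. In particular, this conclusion holds whenever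 $k\le 4$. (b) Suppose that $N_1,\dots,N_k$ are pairwise coprime. If $\prod_{j=1}^k(x-N_j)$ is a CNS polynomial, then for every integer $a$ the element $(a,\dots,a)\in\mathbb Z^k$ has a finite expansion in the simultaneous digit system $(\mathbb Z^k,\varphi,D)$ defined by the $N_j$, where $\varphi(a_1,\dots,a_k)=(N_1a_1,\dots,N_ka_k)$ and $D=\{(c,\dots,c): c=0,1,\dots,|N_1\cdots N_k|-1\}$. In particular, this conclusion holds whenever $k\le 4$. -/

import Mathlib

open Polynomial

noncomputable section

/-- `(V, φ, D)` is a digit system in the abelian group `V`: the endomorphism `φ` has finite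
cokernel, and `D` is a finite subset of `V` that covers all cosets of `φ(V)`. -/
def IsDigitSystem {V : Type*} [AddCommGroup V] (φ : V →+ V) (D : Set V) : Prop :=
  Finite (V ⧸ φ.range) ∧ D.Finite ∧ ∀ v : V, ∃ d ∈ D, v - d ∈ φ.range

/-- `v` has a finite expansion `v = ∑_{i=0}^ℓ φ^i(d_i)` with all `d_i ∈ D`. -/
def HasFiniteExpansion {V : Type*} [AddCommGroup V] (φ : V →+ V) (D : Set V) (v : V) : Prop :=
  ∃ (l : ℕ) (d : ℕ → V), (∀ i ≤ l, d i ∈ D) ∧ v = ∑ i ∈ Finset.range (l + 1), φ^[i] (d i)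

/-- The Finite Expansion Property: every element of `V` has a finite expansion. -/
def FiniteExpansionProperty {V : Type*} [AddCommGroup V] (φ : V →+ V) (D : Set V) : Prop :=
  ∀ v : V, HasFiniteExpansion φ D v

/-- Multiplication by the class `X` of `x` on `ℤ[x]/(f)`. -/
def mulByX (f : ℤ[X]) : AdjoinRoot f →+ AdjoinRoot f :=
  AddMonoidHom.mulLeft (AdjoinRoot.root f)

/-- The classes of the digits `0, 1, …, |f(0)| - 1` in `ℤ[x]/(f)`. -/
def canonicalDigits (f : ℤ[X]) : Set (AdjoinRoot f) :=
  {v | ∃ c : ℤ, 0 ≤ c ∧ c < |f.eval 0| ∧ v = (c : AdjoinRoot f)}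

/-- A monic nonconstant `f ∈ ℤ[x]` with `f(0) ≠ 0` is a CNS polynomial if
`(ℤ[x]/(f), X, {0, …, |f(0)| - 1})` is a digit system with the Finite Expansion Property. -/
def IsCNSPolynomial (f : ℤ[X]) : Prop :=
  f.Monic ∧ 0 < f.natDegree ∧ f.eval 0 ≠ 0 ∧
    IsDigitSystem (mulByX f) (canonicalDigits f) ∧
    FiniteExpansionProperty (mulByX f) (canonicalDigits f)

/-- The map `(a_1, …, a_k) ↦ (N_1 a_1, …, N_k a_k)` on `ℤ^k`. -/
def simultaneousBase {k : ℕ} (N : Fin k → ℤ) : (Fin k → ℤ) →+ (Fin k → ℤ) :=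
  AddMonoidHom.mulLeft N

/-- The digits `(c, c, …, c) ∈ ℤ^k` with `c = 0, 1, …, |N_1 ⋯ N_k| - 1`. -/
def simultaneousDigits {k : ℕ} (N : Fin k → ℤ) : Set (Fin k → ℤ) :=
  {v | ∃ c : ℤ, 0 ≤ c ∧ c < |∏ j, N j| ∧ v = fun _ => c}

/-- The digit sequence `d` (finitely supported, i.e. padded with zeros beyond its leading digit)
is a simultaneous expansion of the integer `a` in the bases `N_1, …, N_k`: all digits lie in
`{0, …, |N_1 ⋯ N_k| - 1}`, and `a = ∑ i, d_i N_j^i` for every `j`. -/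
def IsSimultaneousExpansion {k : ℕ} (N : Fin k → ℤ) (a : ℤ) (d : ℕ →₀ ℤ) : Prop :=
  (∀ i, 0 ≤ d i ∧ d i < |∏ j, N j|) ∧ ∀ j, a = d.sum fun i c => c * N j ^ i

end

/-! Given the CNS property, existence comes from the evaluations `ℤ[x]/(f) → ℤ`, `x ↦ N_j`, applied
to an expansion of the class of `a`. Uniqueness: the difference of two expansions is a polynomial
divisible by `∏ (x - N_j)`, so its lowest nonzero coefficient is a multiple of `∏ N_j`, yet it is a
difference of two digits.

For `k ≤ 4` the CNS property is not used. Put `m_j = -N_j` and `p = ∏ (x + m_j)`. Dividing `a` by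
`p` from the constant term upwards yields digits `d = a + p q` with integer carries `q`, and `d` is
an expansion of `a` once `q` has finite support. With `u_j = 1 / m_j` and `E` the shift, all digits
after the first say `0 ≤ ∏ (E + u_j) q ≤ c < 1`. Inverting the factors one at a time
(`EventuallyWithin.of_add_mul`) traps `q` in `{-2, …, 2}` with few possible transitions;
inequalities between the elementary symmetric functions of the `u_j` then force `q` to vanish
(`ReciprocalBounds.eventually_eq_zero`). Distinctness enters through `m_j ≥ m_0 + j` after sorting.
-/

/-! ### Limiting intervals under inversion of `E + v`. -/

/-- The sequence `y` eventually lies in every neighbourhood of the interval `[A, B]`. -/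
def EventuallyWithin (A B : ℝ) (y : ℕ → ℝ) : Prop :=
  ∀ η : ℝ, 0 < η → ∀ᶠ n in Filter.atTop, A - η ≤ y n ∧ y n ≤ B + η

/-- The conditions make `[A', B']` stable under `y ↦ w - v y` with `w ∈ [A, B]`. An excess `δ / 2 ^
k + η / 2` is at least halved, apart from the error `η / 4`, so it becomes at most `δ / 2 ^ (k + 1)
+ η / 2`. -/
theorem EventuallyWithin.of_add_mul {A B A' B' v V : ℝ} {y : ℕ → ℝ}
    (h : EventuallyWithin A B (fun n => y (n + 1) + v * y n))
    (hv : 0 ≤ v) (hvV : v ≤ V) (hV : V ≤ 1 / 2) (hA' : A' ≤ 0) (hB' : 0 ≤ B')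
    (hA : A' + V * B' ≤ A) (hB : B ≤ B' + V * A') : EventuallyWithin A' B' y := by
  intro η hη
  obtain ⟨m, hm⟩ := Filter.eventually_atTop.1 (h (η / 4) (by positivity))
  have hvA : V * A' ≤ v * A' := mul_le_mul_of_nonpos_right hvV hA'
  have hvB : v * B' ≤ V * B' := mul_le_mul_of_nonneg_right hvV hB'
  set δ : ℝ := |A'| + |B'| + |y m|
  have key : ∀ k : ℕ, A' - (δ * (1 / 2) ^ k + η / 2) ≤ y (m + k) ∧
      y (m + k) ≤ B' + (δ * (1 / 2) ^ k + η / 2) := by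
    intro k
    induction k with
    | zero =>
      have h1 := neg_abs_le A'
      have h2 := le_abs_self A'
      have h3 := neg_abs_le B'
      have h4 := le_abs_self B'
      have h5 := neg_abs_le (y m)
      have h6 := le_abs_self (y m)
      have h7 := abs_nonneg A'
      have h8 := abs_nonneg B'
      simp only [pow_zero, mul_one, add_zero]
      constructor <;> simp only [δ] <;> linarith
    | succ k ih =>
      obtain ⟨h1, h2⟩ := hm (m + k) (Nat.le_add_right _ _)
      have hδ : 0 ≤ δ * (1 / 2) ^ k + η / 2 := by positivity
      have h3 := mul_le_mul_of_nonneg_left ih.1 hv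
      have h4 := mul_le_mul_of_nonneg_left ih.2 hv
      have h5 := mul_le_mul_of_nonneg_right (hvV.trans hV) hδ
      rw [pow_succ, ← add_assoc m k 1]
      constructor <;> linarith
  have hlim : Filter.Tendsto (fun k : ℕ => δ * (1 / 2 : ℝ) ^ k) Filter.atTop (nhds (δ * 0)) :=
    (tendsto_pow_atTop_nhds_zero_of_lt_one (by norm_num) (by norm_num)).const_mul δ
  rw [mul_zero] at hlim
  obtain ⟨K, hK⟩ := Filter.eventually_atTop.1 (hlim.eventually (gt_mem_nhds (half_pos hη)))
  refine Filter.eventually_atTop.2 ⟨m + K, fun n hn => ?_⟩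
  obtain ⟨k, rfl⟩ := Nat.exists_eq_add_of_le (le_of_add_le_left hn)
  have := hK k (by omega)
  have := key k
  constructor <;> linarith

/-- Here `α` is the sum of the endpoints and `β` the length. In these coordinates the extremal case
of `of_add_mul` is diagonal: inversion divides `α` by `1 + V` and `β` by `1 - V`. -/
theorem EventuallyWithin.of_add_mul_symm {α β α' β' v V : ℝ} {y : ℕ → ℝ}
    (h : EventuallyWithin ((α - β) / 2) ((α + β) / 2) (fun n => y (n + 1) + v * y n))
    (hv : 0 ≤ v) (hvV : v ≤ V) (hV : V ≤ 1 / 2) (hα' : 0 ≤ α') (hαβ : α' ≤ β')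
    (hα : α = α' * (1 + V)) (hβ : β = β' * (1 - V)) :
    EventuallyWithin ((α' - β') / 2) ((α' + β') / 2) y :=
  h.of_add_mul hv hvV hV (by linarith) (by linarith) (by subst hα hβ; linarith)
    (by subst hα hβ; linarith)

/-! ### Bounded integer carries eventually vanish. -/

/-- Bounds on the reciprocals of at most four distinct integers `≥ 2`, padded by zeros. -/
structure ReciprocalBounds (u₀ u₁ u₂ u₃ : ℝ) : Prop where
  pos : 0 < u₀
  le_half : u₀ ≤ 1 / 2
  nonneg₁ : 0 ≤ u₁
  nonneg₂ : 0 ≤ u₂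
  nonneg₃ : 0 ≤ u₃
  le₁ : u₁ ≤ u₀ / (1 + u₀)
  le₂ : u₂ ≤ u₀ / (1 + 2 * u₀)
  le₃ : u₃ ≤ u₀ / (1 + 3 * u₀)

theorem ReciprocalBounds.eventually_bounds {u₀ u₁ u₂ u₃ c : ℝ} (hu : ReciprocalBounds u₀ u₁ u₂ u₃)
    (hc0 : 0 ≤ c) (hc1 : c < 1) {q : ℕ → ℝ}
    (hq : ∀ n, 0 ≤ q (n + 4) + (u₀ + u₁ + u₂ + u₃) * q (n + 3) +
        (u₀ * u₁ + u₀ * u₂ + u₀ * u₃ + u₁ * u₂ + u₁ * u₃ + u₂ * u₃) * q (n + 2) +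
        (u₀ * u₁ * u₂ + u₀ * u₁ * u₃ + u₀ * u₂ * u₃ + u₁ * u₂ * u₃) * q (n + 1) +
        u₀ * u₁ * u₂ * u₃ * q n ∧
      q (n + 4) + (u₀ + u₁ + u₂ + u₃) * q (n + 3) +
        (u₀ * u₁ + u₀ * u₂ + u₀ * u₃ + u₁ * u₂ + u₁ * u₃ + u₂ * u₃) * q (n + 2) +
        (u₀ * u₁ * u₂ + u₀ * u₁ * u₃ + u₀ * u₂ * u₃ + u₁ * u₂ * u₃) * q (n + 1) +
        u₀ * u₁ * u₂ * u₃ * q n ≤ c) :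
    ∀ᶠ n in Filter.atTop, (-3 < q n ∧ q n < 3) ∧
      -1 < q (n + 1) + u₀ * q n ∧ q (n + 1) + u₀ * q n < 1 + u₀ := by
  obtain ⟨hp, hh, hn1, hn2, hn3, h1, h2, h3⟩ := hu
  set t := u₀
  have d2 : 0 < 1 - t := by linarith
  have E0 : EventuallyWithin ((c - c) / 2) ((c + c) / 2)
      (fun n => (q (n + 1 + 3) + (t + u₁ + u₂) * q (n + 1 + 2) +
        (t * u₁ + t * u₂ + u₁ * u₂) * q (n + 1 + 1) + t * u₁ * u₂ * q (n + 1)) +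
        u₃ * (q (n + 3) + (t + u₁ + u₂) * q (n + 2) +
        (t * u₁ + t * u₂ + u₁ * u₂) * q (n + 1) + t * u₁ * u₂ * q n)) := by
    intro η hη
    refine Filter.Eventually.of_forall fun n => ?_
    have := hq n
    constructor <;> ring_nf at this ⊢ <;> linarith
  -- With `V_i = t / (1 + i t)`, one has `1 + V_i = (1 + (i + 1) t) / (1 + i t)` and `1 - V_i = (1 +
  -- (i - 1) t) / (1 + i t)`. Removing `u₃`, `u₂`, `u₁`, `u₀` in this order makes the products
  -- telescope.
  have E1 := E0.of_add_mul_symm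
    (y := fun n => q (n + 3) + (t + u₁ + u₂) * q (n + 2) +
        (t * u₁ + t * u₂ + u₁ * u₂) * q (n + 1) + t * u₁ * u₂ * q n)
    (α' := c * ((1 + 3 * t) / (1 + 4 * t))) (β' := c * ((1 + 3 * t) / (1 + 2 * t)))
    hn3 h3 (by rw [div_le_div_iff₀ (by positivity) (by positivity)]; nlinarith) (by positivity)
    (by gcongr; norm_num) (by field_simp; ring) (by field_simp; ring)
  have E1' : EventuallyWithin ((c * ((1 + 3 * t) / (1 + 4 * t)) -
      c * ((1 + 3 * t) / (1 + 2 * t))) / 2) ((c * ((1 + 3 * t) / (1 + 4 * t)) +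
      c * ((1 + 3 * t) / (1 + 2 * t))) / 2)
      (fun n => (q (n + 1 + 2) + (t + u₁) * q (n + 1 + 1) + t * u₁ * q (n + 1)) +
        u₂ * (q (n + 2) + (t + u₁) * q (n + 1) + t * u₁ * q n)) := by
    refine (congrArg _ (_root_.funext fun n => ?_)).mp E1
    ring_nf
  have E2 := E1'.of_add_mul_symm
    (y := fun n => q (n + 2) + (t + u₁) * q (n + 1) + t * u₁ * q n)
    (α' := c * ((1 + 2 * t) / (1 + 4 * t))) (β' := c * ((1 + 3 * t) / (1 + t)))
    hn2 h2 (by rw [div_le_div_iff₀ (by positivity) (by positivity)]; nlinarith) (by positivity)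
    (by gcongr c * (?_ / ?_) <;> linarith) (by field_simp; ring) (by field_simp; ring)
  have E2' : EventuallyWithin ((c * ((1 + 2 * t) / (1 + 4 * t)) -
      c * ((1 + 3 * t) / (1 + t))) / 2) ((c * ((1 + 2 * t) / (1 + 4 * t)) +
      c * ((1 + 3 * t) / (1 + t))) / 2)
      (fun n => (q (n + 1 + 1) + t * q (n + 1)) + u₁ * (q (n + 1) + t * q n)) := by
    refine (congrArg _ (_root_.funext fun n => ?_)).mp E2
    ring_nf
  have hαβ : (1 + t) / (1 + 4 * t) ≤ 1 - t := by
    rw [div_le_iff₀ (by positivity)]; nlinarith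
  have E3 := E2'.of_add_mul_symm (y := fun n => q (n + 1) + t * q n)
    (α' := c * ((1 + t) / (1 + 4 * t))) (β' := c * (1 + 3 * t))
    hn1 h1 (by rw [div_le_div_iff₀ (by positivity) (by positivity)]; nlinarith) (by positivity)
    (mul_le_mul_of_nonneg_left (by linarith) hc0) (by field_simp; ring) (by field_simp; ring)
  have hβ4 : (1 + 3 * t) / (1 - t) ≤ 5 := by
    rw [div_le_iff₀ d2]; linarith
  have hβ4' : 1 ≤ (1 + 3 * t) / (1 - t) := by
    rw [le_div_iff₀ d2]; linarith
  have hα4 : 1 / (1 + 4 * t) ≤ 1 := by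
    rw [div_le_iff₀ (by positivity)]; linarith
  have hα4' : 0 ≤ 1 / (1 + 4 * t) := by positivity
  have E4 := E3.of_add_mul_symm (y := q) (α' := c * (1 / (1 + 4 * t)))
    (β' := c * ((1 + 3 * t) / (1 - t)))
    hp.le le_rfl hh (by positivity)
    (mul_le_mul_of_nonneg_left (by linarith) hc0) (by field_simp) (by field_simp)
  have hlow : 3 * t - 1 ≤ (1 + t) / (1 + 4 * t) := by
    rw [le_div_iff₀ (by positivity)]; nlinarith
  filter_upwards [E3 ((1 - c) / 2) (by linarith), E4 ((1 - c) / 2) (by linarith)] with n a b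
  have m1 := mul_le_mul_of_nonneg_left hαβ hc0
  have m2 := mul_le_mul_of_nonneg_left hβ4 hc0
  have m3 := mul_le_mul_of_nonneg_left hα4 hc0
  have m4 := mul_le_mul_of_nonneg_left hα4' hc0
  have m5 := mul_le_mul_of_nonneg_left hlow hc0
  have m6 : c * t ≤ t := by nlinarith
  refine ⟨⟨?_, ?_⟩, ?_, ?_⟩ <;> linarith

/-- The last expression is `∏ (1 - u_i)`. The others follow from `u₀ ≤ 1/2`, `u₁ ≤ 1/3`, `u₂ ≤ 1/4`,
`u₃ ≤ 1/5`. -/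
theorem ReciprocalBounds.symmetric_inequalities {u₀ u₁ u₂ u₃ : ℝ}
    (hu : ReciprocalBounds u₀ u₁ u₂ u₃) {r₁ r₂ r₃ r₄ : ℝ} (h₁ : r₁ = u₀ + u₁ + u₂ + u₃)
    (h₂ : r₂ = u₀ * u₁ + u₀ * u₂ + u₀ * u₃ + u₁ * u₂ + u₁ * u₃ + u₂ * u₃)
    (h₃ : r₃ = u₀ * u₁ * u₂ + u₀ * u₁ * u₃ + u₀ * u₂ * u₃ + u₁ * u₂ * u₃)
    (h₄ : r₄ = u₀ * u₁ * u₂ * u₃) :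
    0 ≤ r₄ ∧ r₄ ≤ r₃ ∧ r₃ + r₄ ≤ r₂ ∧ r₂ + r₄ < r₁ ∧ 0 < 1 - r₁ + r₂ - r₃ + r₄ := by
  obtain ⟨hp, hh, hn1, hn2, hn3, h1, h2, h3⟩ := hu
  have b1 : u₁ ≤ 1 / 3 := h1.trans (by rw [div_le_div_iff₀ (by positivity) (by norm_num)]; linarith)
  have b2 : u₂ ≤ 1 / 4 := h2.trans (by rw [div_le_div_iff₀ (by positivity) (by norm_num)]; linarith)
  have b3 : u₃ ≤ 1 / 5 := h3.trans (by rw [div_le_div_iff₀ (by positivity) (by norm_num)]; linarith)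
  have p01 : 0 ≤ u₀ * u₁ := by positivity
  have p02 : 0 ≤ u₀ * u₂ := by positivity
  have p12 : 0 ≤ u₁ * u₂ := by positivity
  have p012 : 0 ≤ u₀ * u₁ * u₂ := by positivity
  have q0123 := mul_le_mul_of_nonneg_left b3 p012
  have q012 := mul_le_mul_of_nonneg_left b2 p01
  have q013 := mul_le_mul_of_nonneg_left b3 p01
  have q023 := mul_le_mul_of_nonneg_left b3 p02
  have q123 := mul_le_mul_of_nonneg_left b3 p12
  have q01 := mul_le_mul_of_nonneg_left b1 hp.le
  have q02 := mul_le_mul_of_nonneg_left b2 hp.le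
  have q03 := mul_le_mul_of_nonneg_right hh hn3
  have q12 := mul_le_mul_of_nonneg_left b2 hn1
  have q13 := mul_le_mul_of_nonneg_right b1 hn3
  have q23 := mul_le_mul_of_nonneg_left b3 hn2
  have n03 : 0 ≤ u₀ * u₃ := by positivity
  have n13 : 0 ≤ u₁ * u₃ := by positivity
  have n23 : 0 ≤ u₂ * u₃ := by positivity
  have n013 : 0 ≤ u₀ * u₁ * u₃ := by positivity
  have n023 : 0 ≤ u₀ * u₂ * u₃ := by positivity
  have n123 : 0 ≤ u₁ * u₂ * u₃ := by positivity
  have hprod : 0 < (1 - u₀) * (1 - u₁) * (1 - u₂) * (1 - u₃) :=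
    mul_pos (mul_pos (mul_pos (by linarith) (by linarith)) (by linarith)) (by linarith)
  have hr4 : 0 ≤ u₀ * u₁ * u₂ * u₃ := by positivity
  subst h₁ h₂ h₃ h₄
  refine ⟨hr4, by linarith, by linarith, by linarith, by linarith⟩

theorem ReciprocalBounds.eventually_eq_zero {u₀ u₁ u₂ u₃ c : ℝ} (hu : ReciprocalBounds u₀ u₁ u₂ u₃)
    (hc0 : 0 ≤ c) (hc1 : c < 1) {q : ℕ → ℤ}
    (hq : ∀ n, 0 ≤ (q (n + 4) : ℝ) + (u₀ + u₁ + u₂ + u₃) * q (n + 3) +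
        (u₀ * u₁ + u₀ * u₂ + u₀ * u₃ + u₁ * u₂ + u₁ * u₃ + u₂ * u₃) * q (n + 2) +
        (u₀ * u₁ * u₂ + u₀ * u₁ * u₃ + u₀ * u₂ * u₃ + u₁ * u₂ * u₃) * q (n + 1) +
        u₀ * u₁ * u₂ * u₃ * q n ∧
      (q (n + 4) : ℝ) + (u₀ + u₁ + u₂ + u₃) * q (n + 3) +
        (u₀ * u₁ + u₀ * u₂ + u₀ * u₃ + u₁ * u₂ + u₁ * u₃ + u₂ * u₃) * q (n + 2) +
        (u₀ * u₁ * u₂ + u₀ * u₁ * u₃ + u₀ * u₂ * u₃ + u₁ * u₂ * u₃) * q (n + 1) +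
        u₀ * u₁ * u₂ * u₃ * q n ≤ c) :
    ∃ m, ∀ n, m ≤ n → q n = 0 := by
  obtain ⟨m, hm⟩ := Filter.eventually_atTop.1
    (hu.eventually_bounds hc0 hc1 (q := fun n => (q n : ℝ)) hq)
  obtain ⟨s4, s43, s32, s1, sp⟩ := hu.symmetric_inequalities rfl rfl rfl rfl
  generalize u₀ + u₁ + u₂ + u₃ = r₁ at *
  generalize u₀ * u₁ + u₀ * u₂ + u₀ * u₃ + u₁ * u₂ + u₁ * u₃ + u₂ * u₃ = r₂ at *
  generalize u₀ * u₁ * u₂ + u₀ * u₁ * u₃ + u₀ * u₂ * u₃ + u₁ * u₂ * u₃ = r₃ at *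
  generalize u₀ * u₁ * u₂ * u₃ = r₄ at *
  have hpos := hu.pos
  have hhalf := hu.le_half
  -- transitions among the possible values
  have htr : ∀ n, m ≤ n → (q n = 2 ∧ (q (n + 1) = -1 ∨ q (n + 1) = 0)) ∨
      (q n = 1 ∧ (q (n + 1) = -1 ∨ q (n + 1) = 0)) ∨
      (q n = 0 ∧ (q (n + 1) = 0 ∨ q (n + 1) = 1)) ∨
      (q n = -1 ∧ (q (n + 1) = 0 ∨ q (n + 1) = 1)) ∨
      (q n = -2 ∧ (q (n + 1) = 0 ∨ q (n + 1) = 1 ∨ q (n + 1) = 2)) := by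
    intro n hn
    obtain ⟨⟨a1, a2⟩, a3, a4⟩ := hm n hn
    have b1 : -3 < q n := by exact_mod_cast a1
    have b2 : q n < 3 := by exact_mod_cast a2
    have up : ∀ z : ℤ, (q (n + 1) : ℝ) < z → q (n + 1) < z := fun z h => by exact_mod_cast h
    have lo : ∀ z : ℤ, (z : ℝ) < q (n + 1) → z < q (n + 1) := fun z h => by exact_mod_cast h
    obtain h | h | h | h | h : q n = -2 ∨ q n = -1 ∨ q n = 0 ∨ q n = 1 ∨ q n = 2 := by omega
    all_goals rw [h] at a3 a4; push_cast at a3 a4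
    · have := up 3 (by push_cast; linarith)
      have := lo (-1) (by push_cast; linarith)
      omega
    · have := up 2 (by push_cast; linarith)
      have := lo (-1) (by push_cast; linarith)
      omega
    · have := up 2 (by push_cast; linarith)
      have := lo (-1) (by push_cast; linarith)
      omega
    · have := up 1 (by push_cast; linarith)
      have := lo (-2) (by push_cast; linarith)
      omega
    · have := up 1 (by push_cast; linarith)
      have := lo (-2) (by push_cast; linarith)
      omega
  -- No value leads to `-2`, and only `-2` leads to `2`, so both are gone after two steps.
  have htr' : ∀ n, m + 2 ≤ n → (q n = 1 ∧ (q (n + 1) = -1 ∨ q (n + 1) = 0)) ∨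
      (q n = 0 ∧ (q (n + 1) = 0 ∨ q (n + 1) = 1)) ∨
      (q n = -1 ∧ (q (n + 1) = 0 ∨ q (n + 1) = 1)) := by
    intro n hn
    obtain ⟨k, rfl⟩ := Nat.exists_eq_add_of_le' (show 2 ≤ n by omega)
    have h1 := htr k (by omega)
    have h2 := htr (k + 1) (by omega)
    have h3 := htr (k + 2) (by omega)
    simp only [add_assoc, Nat.reduceAdd] at h2 h3 ⊢
    omega
  -- a digit `-1` is followed by `1`
  have hneg : ∀ n, m + 2 ≤ n → q (n + 3) = -1 → q (n + 4) = 1 := by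
    intro n hn h
    have t0 := htr' n hn
    have t1 := htr' (n + 1) (by omega)
    have t2 := htr' (n + 2) (by omega)
    have t3 := htr' (n + 3) (by omega)
    simp only [add_assoc, Nat.reduceAdd] at t1 t2 t3
    -- Otherwise the sum at `n` would be at most `-r₁ + r₂ + r₄ < 0`.
    by_contra hne
    have h4 : q (n + 4) = 0 := by omega
    have h2 : q (n + 2) = 1 := by omega
    have h1 : q (n + 1) ≤ 0 := by omega
    have h0 : q n ≤ 1 := by omega
    have h1' : (q (n + 1) : ℝ) ≤ 0 := by exact_mod_cast h1
    have h0' : (q n : ℝ) ≤ 1 := by exact_mod_cast h0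
    have := (hq n).1
    rw [h4, h, h2] at this
    push_cast at this
    have e1 := mul_le_mul_of_nonneg_left h1' (s4.trans s43)
    have e2 := mul_le_mul_of_nonneg_left h0' s4
    linarith
  -- After `1, 0`, a next nonzero carry would be `1`, and its sum would be at least `1 > c`, by `r₃
  -- + r₄ ≤ r₂`, then `r₄ ≤ r₃`, then `0 ≤ r₄`.
  have hzero : ∀ n, m + 2 ≤ n → q (n + 2) = 1 → q (n + 3) = 0 → ∀ i, q (n + 3 + i) = 0 := by
    intro n hn h2 h3
    have t0 := htr' n hn
    have t1 := htr' (n + 1) (by omega)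
    have l1 : -1 ≤ q (n + 1) := by omega
    have l0 : -1 ≤ q n := by omega
    have l1' : (-1 : ℝ) ≤ q (n + 1) := by exact_mod_cast l1
    have l0' : (-1 : ℝ) ≤ q n := by exact_mod_cast l0
    have e1 := mul_le_mul_of_nonneg_left l1' (s4.trans s43)
    have e10 := mul_le_mul_of_nonneg_left l1' s4
    have e0 := mul_le_mul_of_nonneg_left l0' s4
    have h4 : q (n + 4) = 0 := by
      have t := htr' (n + 3) (by omega)
      simp only [add_assoc, Nat.reduceAdd] at t
      by_contra hne
      have h4 : q (n + 4) = 1 := by omega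
      have := (hq n).2
      rw [h4, h3, h2] at this
      push_cast at this
      linarith
    have h5 : q (n + 5) = 0 := by
      have t := htr' (n + 4) (by omega)
      simp only [add_assoc, Nat.reduceAdd] at t
      by_contra hne
      have h5 : q (n + 5) = 1 := by omega
      have := (hq (n + 1)).2
      simp only [add_assoc, Nat.reduceAdd] at this
      rw [h5, h4, h3, h2] at this
      push_cast at this
      linarith
    have h6 : q (n + 6) = 0 := by
      have t := htr' (n + 5) (by omega)
      simp only [add_assoc, Nat.reduceAdd] at t
      by_contra hne
      have h6 : q (n + 6) = 1 := by omega
      have := (hq (n + 2)).2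
      simp only [add_assoc, Nat.reduceAdd] at this
      rw [h6, h5, h4, h3, h2] at this
      push_cast at this
      linarith
    have hall : ∀ i, q (n + 3 + i) = 0 ∧ q (n + 4 + i) = 0 ∧ q (n + 5 + i) = 0 ∧
        q (n + 6 + i) = 0 := by
      intro i
      induction i with
      | zero => exact ⟨h3, h4, h5, h6⟩
      | succ i ih =>
        obtain ⟨i3, i4, i5, i6⟩ := ih
        have c4 : n + 3 + (i + 1) = n + 4 + i := by omega
        have c5 : n + 4 + (i + 1) = n + 5 + i := by omega
        have c6 : n + 5 + (i + 1) = n + 6 + i := by omega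
        rw [c4, c5, c6]
        refine ⟨i4, i5, i6, ?_⟩
        have t := htr' (n + 6 + i) (by omega)
        by_contra hne
        have h7 : q (n + 6 + i + 1) = 1 := by
          rw [show n + 6 + (i + 1) = n + 6 + i + 1 by omega] at hne
          omega
        have := (hq (n + 3 + i)).2
        rw [show n + 3 + i + 4 = n + 6 + i + 1 by omega, show n + 3 + i + 3 = n + 6 + i by omega,
          show n + 3 + i + 2 = n + 5 + i by omega, show n + 3 + i + 1 = n + 4 + i by omega,
          h7, i3, i4, i5, i6] at this
        push_cast at this
        linarith
    exact fun i => (hall i).1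
  by_cases hone : ∃ n, m + 4 ≤ n ∧ q n = 1
  · obtain ⟨n, hn, h1⟩ := hone
    have step : ∀ i, m + 4 ≤ i → q i = 1 →
        (∃ M, ∀ n, M ≤ n → q n = 0) ∨ (q (i + 1) = -1 ∧ q (i + 2) = 1) := by
      intro i hi h
      have t := htr' i (by omega)
      obtain h' | h' : q (i + 1) = -1 ∨ q (i + 1) = 0 := by omega
      · right
        obtain ⟨k, rfl⟩ := Nat.exists_eq_add_of_le' (show 2 ≤ i by omega)
        exact ⟨h', hneg k (by omega) h'⟩
      · left
        obtain ⟨k, rfl⟩ := Nat.exists_eq_add_of_le' (show 2 ≤ i by omega)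
        refine ⟨k + 3, fun j hj => ?_⟩
        obtain ⟨l, rfl⟩ := Nat.exists_eq_add_of_le hj
        exact hzero k (by omega) h h' l
    rcases step n hn h1 with h | ⟨h2, h3⟩
    · exact h
    rcases step (n + 2) (by omega) h3 with h | ⟨h4, h5⟩
    · exact h
    rcases step (n + 4) (by omega) h5 with h | ⟨h6, h7⟩
    · exact h
    -- The window `-1, 1, -1, 1, -1` has the sum `-∏ (1 - u_i) < 0`.
    have := (hq (n + 1)).1
    simp only [add_assoc, Nat.reduceAdd] at this h4 h5 h6
    rw [h6, h5, h4, h3, h2] at this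
    push_cast at this
    linarith
  · push Not at hone
    refine ⟨m + 5, fun n hn => ?_⟩
    obtain ⟨k, rfl⟩ := Nat.exists_eq_add_of_le' (show 1 ≤ n by omega)
    have t := htr' k (by omega)
    have h1 := hone k (by omega)
    have h2 := hone (k + 1) (by omega)
    omega

/-! ### Division with carries. -/

/-- The input `a` at time `0`, and no input later. -/
def impulse (a : ℤ) (n : ℕ) : ℤ := if n = 0 then a else 0

/-- Four consecutive carries in the division of `a` by `p₀ + p₁ x + ⋯ + p₄ x ^ 4`. -/
def carryState (p₀ p₁ p₂ p₃ p₄ a : ℤ) : ℕ → ℤ × ℤ × ℤ × ℤ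
  | 0 => (0, 0, 0, 0)
  | n + 1 =>
    let s := carryState p₀ p₁ p₂ p₃ p₄ a n
    (s.2.1, s.2.2.1, s.2.2.2,
      -((impulse a n + p₁ * s.2.2.2 + p₂ * s.2.2.1 + p₃ * s.2.1 + p₄ * s.1) / p₀))

theorem exists_carry_sequence (p₀ p₁ p₂ p₃ p₄ a : ℤ) (hp : 0 < p₀) :
    ∃ q : ℕ → ℤ, q 0 = 0 ∧ q 1 = 0 ∧ q 2 = 0 ∧ q 3 = 0 ∧
      ∀ n, 0 ≤ impulse a n + p₀ * q (n + 4) + p₁ * q (n + 3) + p₂ * q (n + 2) + p₃ * q (n + 1) +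
          p₄ * q n ∧
        impulse a n + p₀ * q (n + 4) + p₁ * q (n + 3) + p₂ * q (n + 2) + p₃ * q (n + 1) +
          p₄ * q n < p₀ := by
  refine ⟨fun n => (carryState p₀ p₁ p₂ p₃ p₄ a n).1, rfl, rfl, rfl, rfl, fun n => ?_⟩
  simp only [carryState]
  generalize carryState p₀ p₁ p₂ p₃ p₄ a n = s
  set w := impulse a n + p₁ * s.2.2.2 + p₂ * s.2.2.1 + p₃ * s.2.1 + p₄ * s.1 with hw
  have h1 := Int.mul_ediv_add_emod w p₀
  have h2 := Int.emod_nonneg w hp.ne'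
  have h3 := Int.emod_lt_of_pos w hp
  constructor <;> linarith

theorem ReciprocalBounds.exists_expansion {u₀ u₁ u₂ u₃ : ℝ} (hu : ReciprocalBounds u₀ u₁ u₂ u₃)
    {p₀ p₁ p₂ p₃ p₄ : ℤ} (hp : 0 < p₀) (h₁ : (p₁ : ℝ) = p₀ * (u₀ + u₁ + u₂ + u₃))
    (h₂ : (p₂ : ℝ) = p₀ * (u₀ * u₁ + u₀ * u₂ + u₀ * u₃ + u₁ * u₂ + u₁ * u₃ + u₂ * u₃))
    (h₃ : (p₃ : ℝ) = p₀ * (u₀ * u₁ * u₂ + u₀ * u₁ * u₃ + u₀ * u₂ * u₃ + u₁ * u₂ * u₃))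
    (h₄ : (p₄ : ℝ) = p₀ * (u₀ * u₁ * u₂ * u₃)) (a : ℤ) :
    ∃ d : ℕ →₀ ℤ, (∀ i, 0 ≤ d i ∧ d i < p₀) ∧
      ∀ z : ℤ, p₀ + p₁ * z + p₂ * z ^ 2 + p₃ * z ^ 3 + p₄ * z ^ 4 = 0 →
        a = d.sum fun i c => c * z ^ i := by
  obtain ⟨q, q0, q1, q2, q3, hq⟩ := exists_carry_sequence p₀ p₁ p₂ p₃ p₄ a hp
  have hp' : (0 : ℝ) < p₀ := by exact_mod_cast hp
  have hp1 : (1 : ℝ) ≤ p₀ := by exact_mod_cast hp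
  -- The shift by one skips the input at time `0`. Integer digits are at most `p₀ - 1`, which gives
  -- `c` after division by `p₀`.
  obtain ⟨M, hM⟩ := hu.eventually_eq_zero (c := ((p₀ : ℝ) - 1) / p₀) (q := fun n => q (n + 1))
    (div_nonneg (by linarith) hp'.le) (by rw [div_lt_one hp']; linarith) (fun n => by
      obtain ⟨l, u⟩ := hq (n + 1)
      have u' := Int.le_sub_one_of_lt u
      simp only [impulse, Nat.succ_ne_zero, if_false, zero_add] at l u'
      have l'' : (0 : ℝ) ≤ p₀ * q (n + 1 + 4) + p₁ * q (n + 1 + 3) + p₂ * q (n + 1 + 2) +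
        p₃ * q (n + 1 + 1) + p₄ * q (n + 1) := by exact_mod_cast l
      have u'' : (p₀ * q (n + 1 + 4) + p₁ * q (n + 1 + 3) + p₂ * q (n + 1 + 2) +
        p₃ * q (n + 1 + 1) + p₄ * q (n + 1) : ℝ) ≤ p₀ - 1 := by exact_mod_cast u'
      rw [h₁, h₂, h₃, h₄] at l'' u''
      rw [show n + 4 + 1 = n + 1 + 4 by omega, show n + 3 + 1 = n + 1 + 3 by omega,
        show n + 2 + 1 = n + 1 + 2 by omega]
      constructor
      · refine nonneg_of_mul_nonneg_right (a := (p₀ : ℝ)) ?_ hp'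
        linarith
      · rw [le_div_iff₀ hp']
        linarith)
  have hM' : ∀ n, M + 1 ≤ n → q n = 0 := fun n hn => by
    obtain ⟨k, rfl⟩ := Nat.exists_eq_add_of_le' (show 1 ≤ n by omega)
    exact hM k (by omega)
  set d : ℕ → ℤ := fun n => impulse a n + p₀ * q (n + 4) + p₁ * q (n + 3) + p₂ * q (n + 2) +
    p₃ * q (n + 1) + p₄ * q n with hd
  have hd0 : ∀ n, M + 1 ≤ n → d n = 0 := by
    intro n hn
    simp only [hd, impulse]
    rw [if_neg (by omega), hM' n hn, hM' (n + 1) (by omega), hM' (n + 2) (by omega),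
      hM' (n + 3) (by omega), hM' (n + 4) (by omega)]
    ring
  have hsupp : Function.support d ⊆ Finset.range (M + 1) := fun n hn => by
    simp only [Finset.coe_range, Set.mem_Iio]
    by_contra h
    exact hn (hd0 n (by omega))
  refine ⟨Finsupp.ofSupportFinite d ((Finset.finite_toSet _).subset hsupp), fun i => hq i, ?_⟩
  intro z hz
  rw [Finsupp.sum_of_support_subset (s := Finset.range (M + 1)) _ (fun n hn => by
    exact_mod_cast hsupp (by simpa [Finsupp.ofSupportFinite] using hn)) _ (by simp)]
  -- Partial expansion plus the remainder still held in the carries; the induction step uses `p(z) =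
  -- 0`.
  have key : ∀ n, a = ∑ i ∈ Finset.range n, d i * z ^ i + z ^ n * (impulse a n +
      (p₁ * q (n + 3) + p₂ * q (n + 2) + p₃ * q (n + 1) + p₄ * q n) +
      z * (p₂ * q (n + 3) + p₃ * q (n + 2) + p₄ * q (n + 1)) +
      z ^ 2 * (p₃ * q (n + 3) + p₄ * q (n + 2)) + z ^ 3 * (p₄ * q (n + 3))) := by
    intro n
    induction n with
    | zero => simp [impulse, q0, q1, q2, q3]
    | succ n ih =>
      rw [Finset.sum_range_succ]
      have hi : impulse a (n + 1) = 0 := by simp [impulse]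
      rw [hi]
      simp only [hd, add_assoc, Nat.reduceAdd] at ih ⊢
      linear_combination ih - z ^ n * q (n + 4) * hz
  have := key (M + 1)
  rw [hM' (M + 1) (by omega), hM' (M + 1 + 1) (by omega), hM' (M + 1 + 2) (by omega),
    hM' (M + 1 + 3) (by omega)] at this
  simpa [impulse, Finsupp.ofSupportFinite_coe] using this

/-! ### At most four distinct bases. -/

theorem one_div_le_of_add_le {x y j : ℝ} (hx : 0 < x) (hj : 0 ≤ j) (h : x + j ≤ y) :
    1 / y ≤ 1 / x / (1 + j * (1 / x)) := by
  have : 1 / x / (1 + j * (1 / x)) = 1 / (x + j) := by field_simp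
  rw [this]
  exact one_div_le_one_div_of_le (by positivity) h

theorem exists_expansion_of_strictMono {k : ℕ} (hk : 1 ≤ k) (hk4 : k ≤ 4) {m : Fin k → ℤ}
    (hm : StrictMono m) (h2 : ∀ i, 2 ≤ m i) (a : ℤ) :
    ∃ d : ℕ →₀ ℤ, (∀ i, 0 ≤ d i ∧ d i < ∏ j, m j) ∧
      ∀ j, a = d.sum fun i c => c * (-m j) ^ i := by
  have nonneg : ∀ x j : ℝ, 2 ≤ x → 0 ≤ j → 0 ≤ 1 / x / (1 + j * (1 / x)) := by
    intro x j hx hj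
    positivity
  have nonneg1 : ∀ x : ℝ, 2 ≤ x → 0 ≤ 1 / x / (1 + 1 / x) := by
    intro x hx
    positivity
  have half : ∀ x : ℝ, 2 ≤ x → 1 / x ≤ 1 / 2 := fun x hx =>
    one_div_le_one_div_of_le (by norm_num) hx
  have h0 := h2 ⟨0, hk⟩
  have h0' : (2 : ℝ) ≤ m ⟨0, hk⟩ := by exact_mod_cast h0
  have le1 : ∀ x y : ℤ, 2 ≤ x → x < y → (1 / y : ℝ) ≤ 1 / x / (1 + 1 / x) := by
    intro x y hx h
    have hx' : (2 : ℝ) ≤ x := by exact_mod_cast hx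
    have h' : (x + 1 : ℝ) ≤ y := by exact_mod_cast h
    simpa using one_div_le_of_add_le (by linarith) zero_le_one h'
  have le : ∀ (x y : ℤ) (j : ℕ), 2 ≤ x → x + j ≤ y → (1 / y : ℝ) ≤ 1 / x / (1 + j * (1 / x)) := by
    intro x y j hx h
    have hx' : (2 : ℝ) ≤ x := by exact_mod_cast hx
    have h' : (x + j : ℝ) ≤ y := by exact_mod_cast h
    exact one_div_le_of_add_le (by linarith) (by positivity) h'
  obtain rfl | rfl | rfl | rfl : k = 1 ∨ k = 2 ∨ k = 3 ∨ k = 4 := by omega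
  -- For `k < 4` the missing reciprocals are `0`, which lowers the degree of `p` without changing
  -- the recurrence.
  · have g0 : (2 : ℤ) ≤ m 0 := h0
    have r0 : (2 : ℝ) ≤ m 0 := h0'
    have hu : ReciprocalBounds (1 / m 0) 0 0 0 :=
      ⟨by positivity, half _ h0', le_rfl, le_rfl, le_rfl, nonneg1 _ h0',
        nonneg _ 2 h0' (by norm_num), nonneg _ 3 h0' (by norm_num)⟩
    obtain ⟨d, hd, hs⟩ := hu.exists_expansion (p₀ := m 0) (p₁ := 1) (p₂ := 0) (p₃ := 0) (p₄ := 0)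
      (by linarith) (by push_cast; field_simp; ring) (by push_cast; ring) (by push_cast; ring)
      (by push_cast; ring) a
    refine ⟨d, by simpa using hd, fun j => hs _ ?_⟩
    fin_cases j
    simp
  · have l1 : m 0 < m 1 := hm (by decide)
    have g0 : (2 : ℤ) ≤ m 0 := h0
    have r0 : (2 : ℝ) ≤ m 0 := h0'
    have r1 : (2 : ℝ) ≤ m 1 := by exact_mod_cast h2 1
    have hu : ReciprocalBounds (1 / m 0) (1 / m 1) 0 0 :=
      ⟨by positivity, half _ h0', by positivity, le_rfl, le_rfl, le1 _ _ g0 l1,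
        nonneg _ 2 h0' (by norm_num), nonneg _ 3 h0' (by norm_num)⟩
    obtain ⟨d, hd, hs⟩ := hu.exists_expansion (p₀ := m 0 * m 1) (p₁ := m 0 + m 1) (p₂ := 1)
      (p₃ := 0) (p₄ := 0)
      (by nlinarith) (by push_cast; field_simp; ring) (by push_cast; field_simp; ring)
      (by push_cast; ring) (by push_cast; ring) a
    refine ⟨d, by simpa [Fin.prod_univ_two] using hd, fun j => hs _ ?_⟩
    fin_cases j <;> simp <;> ring
  · have l1 : m 0 < m 1 := hm (by decide)
    have l2 : m 1 < m 2 := hm (by decide)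
    have g0 : (2 : ℤ) ≤ m 0 := h0
    have g1 : (2 : ℤ) ≤ m 1 := h2 1
    have g2 : (2 : ℤ) ≤ m 2 := h2 2
    have r0 : (2 : ℝ) ≤ m 0 := h0'
    have r1 : (2 : ℝ) ≤ m 1 := by exact_mod_cast g1
    have r2 : (2 : ℝ) ≤ m 2 := by exact_mod_cast g2
    have hu : ReciprocalBounds (1 / m 0) (1 / m 1) (1 / m 2) 0 :=
      ⟨by positivity, half _ h0', by positivity, by positivity, le_rfl, le1 _ _ g0 l1,
        le _ _ 2 g0 (by push_cast; linarith), nonneg _ 3 h0' (by norm_num)⟩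
    obtain ⟨d, hd, hs⟩ := hu.exists_expansion (p₀ := m 0 * m 1 * m 2)
      (p₁ := m 0 * m 1 + m 0 * m 2 + m 1 * m 2) (p₂ := m 0 + m 1 + m 2) (p₃ := 1) (p₄ := 0)
      (by positivity) (by push_cast; field_simp; ring) (by push_cast; field_simp; ring)
      (by push_cast; field_simp; ring) (by push_cast; ring) a
    refine ⟨d, by simpa [Fin.prod_univ_three] using hd, fun j => hs _ ?_⟩
    fin_cases j <;> simp <;> ring
  · have l1 : m 0 < m 1 := hm (by decide)
    have l2 : m 1 < m 2 := hm (by decide)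
    have l3 : m 2 < m 3 := hm (by decide)
    have g0 : (2 : ℤ) ≤ m 0 := h0
    have g1 : (2 : ℤ) ≤ m 1 := h2 1
    have g2 : (2 : ℤ) ≤ m 2 := h2 2
    have g3 : (2 : ℤ) ≤ m 3 := h2 3
    have r0 : (2 : ℝ) ≤ m 0 := h0'
    have r1 : (2 : ℝ) ≤ m 1 := by exact_mod_cast g1
    have r2 : (2 : ℝ) ≤ m 2 := by exact_mod_cast g2
    have r3 : (2 : ℝ) ≤ m 3 := by exact_mod_cast g3
    have hu : ReciprocalBounds (1 / m 0) (1 / m 1) (1 / m 2) (1 / m 3) :=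
      ⟨by positivity, half _ h0', by positivity, by positivity, by positivity, le1 _ _ g0 l1,
        le _ _ 2 g0 (by push_cast; linarith), le _ _ 3 g0 (by push_cast; linarith)⟩
    obtain ⟨d, hd, hs⟩ := hu.exists_expansion (p₀ := m 0 * m 1 * m 2 * m 3)
      (p₁ := m 0 * m 1 * m 2 + m 0 * m 1 * m 3 + m 0 * m 2 * m 3 + m 1 * m 2 * m 3)
      (p₂ := m 0 * m 1 + m 0 * m 2 + m 0 * m 3 + m 1 * m 2 + m 1 * m 3 + m 2 * m 3)
      (p₃ := m 0 + m 1 + m 2 + m 3) (p₄ := 1)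
      (by positivity) (by push_cast; field_simp; ring) (by push_cast; field_simp; ring)
      (by push_cast; field_simp; ring) (by push_cast; field_simp) a
    refine ⟨d, by simpa [Fin.prod_univ_four] using hd, fun j => hs _ ?_⟩
    fin_cases j <;> simp <;> ring

theorem abs_prod_eq_prod_neg {k : ℕ} {N : Fin k → ℤ} (hN : ∀ j, N j ≤ -2) :
    |∏ j, N j| = ∏ j, -N j := by
  rw [Finset.abs_prod]
  exact Finset.prod_congr rfl fun j _ => abs_of_nonpos (by linarith [hN j])

theorem exists_isSimultaneousExpansion_of_le_four {k : ℕ} (hk : 1 ≤ k) (hk4 : k ≤ 4)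
    {N : Fin k → ℤ} (hN : ∀ j, N j ≤ -2) (hinj : Function.Injective N) (a : ℤ) :
    ∃ d : ℕ →₀ ℤ, IsSimultaneousExpansion N a d := by
  set m : Fin k → ℤ := fun j => -N j
  set σ := Tuple.sort m
  have hm : StrictMono (m ∘ σ) := (Tuple.monotone_sort m).strictMono_of_injective
    ((neg_injective.comp hinj).comp σ.injective)
  obtain ⟨d, hd, hs⟩ := exists_expansion_of_strictMono hk hk4 hm
    (fun i => by have := hN (σ i); simp only [m, Function.comp_apply]; linarith) a
  refine ⟨d, ?_, fun j => ?_⟩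
  · rw [abs_prod_eq_prod_neg hN]
    rw [show ∏ j, (m ∘ σ) j = ∏ j, -N j from Equiv.prod_comp σ m] at hd
    exact hd
  · have := hs (σ.symm j)
    simpa [m] using this

/-! ### Existence from the CNS property. -/

theorem IsCNSPolynomial.exists_isSimultaneousExpansion {k : ℕ} {N : Fin k → ℤ}
    (h : IsCNSPolynomial (∏ j, (X - C (N j)))) (a : ℤ) :
    ∃ d : ℕ →₀ ℤ, IsSimultaneousExpansion N a d := by
  obtain ⟨-, -, h0, -, hF⟩ := h
  have hev : |(∏ j, (X - C (N j))).eval 0| = |∏ j, N j| := by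
    rw [eval_prod, Finset.abs_prod, Finset.abs_prod]
    simp
  obtain ⟨l, d, hd, hsum⟩ := hF (a : AdjoinRoot (∏ j, (X - C (N j))))
  have hd' : ∀ i, ∃ c : ℤ, (0 ≤ c ∧ c < |∏ j, N j|) ∧ (i ≤ l → d i = c) := by
    intro i
    by_cases hi : i ≤ l
    · obtain ⟨c, h1, h2, h3⟩ := hd i hi
      exact ⟨c, ⟨h1, hev ▸ h2⟩, fun _ => h3⟩
    · exact ⟨0, ⟨le_rfl, by rw [← hev]; exact abs_pos.2 h0⟩, fun h => absurd h hi⟩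
  choose c hc hdc using hd'
  set e : ℕ → ℤ := fun i => if i ≤ l then c i else 0 with he
  have hsupp : Function.support e ⊆ Finset.range (l + 1) := fun n hn => by
    simp only [Finset.coe_range, Set.mem_Iio]
    by_contra h
    exact hn (if_neg (by omega))
  refine ⟨Finsupp.ofSupportFinite e ((Finset.finite_toSet _).subset hsupp), fun i => ?_,
    fun j => ?_⟩
  · rw [Finsupp.ofSupportFinite_coe]
    by_cases hi : i ≤ l
    · simpa [he, hi] using hc i
    · simpa [he, hi] using (hc i).1.trans_lt (hc i).2
  · rw [Finsupp.sum_of_support_subset (s := Finset.range (l + 1)) _ (fun n hn => by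
      exact_mod_cast hsupp (by simpa [Finsupp.ofSupportFinite] using hn)) _ (by simp)]
    have hroot : (∏ j, (X - C (N j))).eval₂ (RingHom.id ℤ) (N j) = 0 := by
      rw [eval₂_id, eval_prod]
      exact Finset.prod_eq_zero (Finset.mem_univ j) (by simp)
    have hit : ∀ (i : ℕ) v, (mulByX (∏ j, (X - C (N j))))^[i] v = AdjoinRoot.root _ ^ i * v := by
      intro i v
      induction i with
      | zero => simp
      | succ i ih =>
        rw [Function.iterate_succ_apply', ih, pow_succ']
        simp [mulByX, mul_assoc]
    have := congrArg (AdjoinRoot.lift (RingHom.id ℤ) (N j) hroot) hsum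
    rw [map_intCast, map_sum] at this
    simp only [Int.cast_id] at this
    rw [this]
    refine Finset.sum_congr rfl fun i hi => ?_
    have hi' : i ≤ l := by simpa [Nat.lt_succ_iff] using hi
    rw [hit, hdc i hi', map_mul, map_pow, AdjoinRoot.lift_root, map_intCast,
      Finsupp.ofSupportFinite_coe]
    simp [he, hi', mul_comm]

/-! ### Uniqueness of the digits, and part (b). -/

theorem IsSimultaneousExpansion.unique {k : ℕ} {N : Fin k → ℤ} (hN : ∀ j, N j ≤ -2)
    (hinj : Function.Injective N) {a : ℤ} {d d' : ℕ →₀ ℤ} (h : IsSimultaneousExpansion N a d)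
    (h' : IsSimultaneousExpansion N a d') : d = d' := by
  by_contra hne
  set p : ℤ[X] := ⟨.ofCoeff d⟩ - ⟨.ofCoeff d'⟩ with hp
  have hcoeff : ∀ i, p.coeff i = d i - d' i := fun i => by rw [hp, coeff_sub]; rfl
  have hp0 : p ≠ 0 := fun h0 => hne <| Finsupp.ext fun i => by
    have := hcoeff i
    rw [h0, coeff_zero] at this
    linarith
  have heval : ∀ j, p.eval (N j) = 0 := by
    intro j
    have e1 : ∀ d : ℕ →₀ ℤ, (⟨.ofCoeff d⟩ : ℤ[X]).eval (N j) = d.sum fun i c => c * N j ^ i := by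
      intro d
      rw [eval_eq_sum]
      rfl
    rw [hp, eval_sub, e1, e1, ← h.2 j, ← h'.2 j, sub_self]
  -- Removing the power of `X` makes the lowest nonzero digit difference the constant term of `g`;
  -- the roots `N j` survive because they are nonzero.
  obtain ⟨g, hg, hdvd⟩ := exists_eq_pow_rootMultiplicity_mul_and_not_dvd p hp0 0
  set r := p.rootMultiplicity 0
  rw [C_0, sub_zero] at hg hdvd
  have hg0 : g.coeff 0 ≠ 0 := fun h0 => hdvd (X_dvd_iff.2 h0)
  have hgp : g.coeff 0 = d r - d' r := by
    rw [← hcoeff, hg]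
    simpa using (coeff_X_pow_mul g r 0).symm
  have hgne : g ≠ 0 := fun h0 => hg0 (by simp [h0])
  have hroots : (Finset.univ.val.map N) ≤ g.roots := by
    rw [Multiset.le_iff_subset (Multiset.Nodup.map hinj Finset.univ.nodup)]
    intro x hx
    obtain ⟨j, -, rfl⟩ := Multiset.mem_map.1 hx
    rw [mem_roots hgne, IsRoot.def]
    have := heval j
    rw [hg, eval_mul, eval_pow, eval_X] at this
    exact (mul_eq_zero.1 this).resolve_left (pow_ne_zero _ (by linarith [hN j]))
  have hdiv := (Multiset.prod_X_sub_C_dvd_iff_le_roots hgne _).2 hroots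
  rw [Multiset.map_map] at hdiv
  obtain ⟨w, hw⟩ := hdiv
  have hg' : g.coeff 0 = (∏ j, -N j) * w.coeff 0 := by
    rw [hw, mul_coeff_zero]
    congr 1
    rw [coeff_zero_eq_eval_zero]
    change (∏ j, (X - C (N j))).eval 0 = _
    rw [eval_prod]
    simp
  rw [← abs_prod_eq_prod_neg hN] at hg'
  have hle := Int.le_of_dvd (abs_pos.2 hg0) ((dvd_abs _ _).2 ⟨_, hg'⟩)
  have := h.1 r
  have := h'.1 r
  rw [hgp] at hle
  exact absurd hle (not_le.2 (abs_lt.2 ⟨by linarith, by linarith⟩))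

theorem IsSimultaneousExpansion.hasFiniteExpansion {k : ℕ} {N : Fin k → ℤ} {a : ℤ} {d : ℕ →₀ ℤ}
    (h : IsSimultaneousExpansion N a d) :
    HasFiniteExpansion (simultaneousBase N) (simultaneousDigits N) (fun _ => a) := by
  refine ⟨d.support.sup id, fun i _ => d i, fun i _ => ⟨d i, (h.1 i).1, (h.1 i).2, rfl⟩, ?_⟩
  have hit : ∀ (i : ℕ) (v : Fin k → ℤ), (simultaneousBase N)^[i] v = N ^ i * v := by
    intro i v
    induction i with
    | zero => simp
    | succ i ih =>
      rw [Function.iterate_succ_apply', ih, pow_succ']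
      simp [simultaneousBase, mul_assoc]
  ext j
  rw [Finset.sum_apply, h.2 j, Finsupp.sum_of_support_subset d
    (s := Finset.range (d.support.sup id + 1)) (fun n hn => by
      simpa [Nat.lt_succ_iff] using Finset.le_sup (f := id) hn) _ (by simp)]
  refine Finset.sum_congr rfl fun i _ => ?_
  rw [hit]
  simp [mul_comm]

/-- Equal coprime integers are units, so pairwise coprimality reduces (b) to the distinct case. -/
theorem injective_of_pairwise_isCoprime {k : ℕ} {N : Fin k → ℤ} (hN : ∀ j, N j ≤ -2)
    (h : Pairwise (fun i j => IsCoprime (N i) (N j))) : Function.Injective N := by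
  intro i j hij
  by_contra hne
  have hc := h hne
  simp only [hij, isCoprime_self] at hc
  have := hN j
  rcases Int.isUnit_iff.1 hc with h1 | h1 <;> omega

theorem mainTheorem5 (k : ℕ) (hk : 1 ≤ k) (N : Fin k → ℤ) (hN : ∀ j, N j ≤ -2) :
    (Function.Injective N →
      (IsCNSPolynomial (∏ j, (X - C (N j))) →
        ∀ a : ℤ, ∃! d : ℕ →₀ ℤ, IsSimultaneousExpansion N a d) ∧
      (k ≤ 4 → ∀ a : ℤ, ∃! d : ℕ →₀ ℤ, IsSimultaneousExpansion N a d)) ∧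
    (Pairwise (fun i j => IsCoprime (N i) (N j)) →
      (IsCNSPolynomial (∏ j, (X - C (N j))) →
        ∀ a : ℤ, HasFiniteExpansion (simultaneousBase N) (simultaneousDigits N) (fun _ => a)) ∧
      (k ≤ 4 →
        ∀ a : ℤ, HasFiniteExpansion (simultaneousBase N) (simultaneousDigits N) (fun _ => a))) := by
  have exists_unique {a : ℤ} (hinj : Function.Injective N)
      (h : ∃ d : ℕ →₀ ℤ, IsSimultaneousExpansion N a d) :
      ∃! d : ℕ →₀ ℤ, IsSimultaneousExpansion N a d :=
    h.imp fun _ hd => ⟨hd, fun _ hd' => hd'.unique hN hinj hd⟩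
  refine ⟨fun hinj => ⟨fun h a => exists_unique hinj (h.exists_isSimultaneousExpansion a),
    fun hk4 a => exists_unique hinj (exists_isSimultaneousExpansion_of_le_four hk hk4 hN hinj a)⟩,
    fun hcop => ⟨fun h a => ?_, fun hk4 a => ?_⟩⟩
  · obtain ⟨d, hd⟩ := h.exists_isSimultaneousExpansion a
    exact hd.hasFiniteExpansion
  · obtain ⟨d, hd⟩ := exists_isSimultaneousExpansion_of_le_four hk hk4 hN
      (injective_of_pairwise_isCoprime hN hcop) a
    exact hd.hasFiniteExpansion
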